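/- Let $d\in\mathbb N$, let $\mathbb B_d\subset\mathbb C^d$ be the open Euclidean unit ball, and let $\langle z,w\rangle=\sum_i z_i\overline{w_i}$. Let $H^2_d$ (the Drury–Arveson space) and $h^2_d$ (the pluriharmonic Drury–Arveson space) be the complex reproducing kernel Hilbert spaces on $\mathbb B_d$ with kernels $$K_{H^2_d}(z,w)=\frac1{1-\langle z,w\rangle},\qquad K_{h^2_d}(z,w)=2\,\mathrm{Re}\,\frac1{1-\langle z,w\rangle}-1 .$$ For $\mathcal H\in\{H^2_d,h^2_d\}$ with kernel $K$, the energy of a Borel probability measure $\mu$ on $\overline{\mathbb B_d}$ is $$\mathcal E_{\mathcal H}(\mu)=\sup_{0\le r<1}\iint \mathrm{Re}\,K(rz,rw)\,d\mu(w)\,d\mu(z)\in[0,\infty].$$ For compact $F\subset\overline{\mathbb B_d}$ put $\mathrm{cap}_{\mathcal H}(F)=\sup\{1/\mathcal E_{\mathcal H}(\mu):\mu$ a Borel probability measure supported on $F\}$ (which is $0$ if $F=\emptyset$). For arbitrary $E\subset\overline{\mathbb B_d}$ put $\mathrm{cap}_{\mathcal H}(E)=\sup\{\mathrm{cap}_{\mathcal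 H}(F):F\subset E\text{ compact}\}$, and define the outer capacity $\mathrm{cap}^*_{\mathcal H}(E)=\inf\{\mathrm{cap}_{\mathcal H}(G):G\supset E,\ G\text{ relatively open in }\overline{\mathbb B_d}\}$. A function $f:\mathbb B_d\to\mathbb C$ has a Korányi limit at $\zeta\in\partial\mathbb B_d$ if there is $\lambda\in\mathbb C$ such that for every $\alpha>1$ one has $f(z)\to\lambda$ as $z\to\zeta$ within $D_\alpha(\zeta)=\{z\in\mathbb B_d:|1-\langle z,\zeta\rangle|<\tfrac\alpha2(1-\|z\|^2)\}$. **Theorem.** (a) For every $f\in H^2_d$ there is a Borel set $E\subset\partial\mathbb B_d$ with $\mathrm{cap}^*_{H^2_d}(E)=0$ such that $f$ has a Korányi limit at every point of $\partial\mathbb B_d\setminus E$. (b) For every $f\in h^2_d$ there is a Borel set $E\subset\partial\mathbb B_d$ with $\mathrm{cap}^*_{h^2_d}(E)=0$ and $\mathrm{cap}^*_{H^2_d}(E)=0$ such that $f$ has a Korányi limit at every point of $\partial\mathbb B_d\setminus E$. -/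

import Mathlib

open MeasureTheory Filter Topology Set
open scoped ENNReal ComplexConjugate

noncomputable section

namespace DruryArveson

/-- Complex Euclidean space `ℂ^d`. -/
abbrev Cd (d : ℕ) : Type := EuclideanSpace ℂ (Fin d)

/-- The open unit ball of `ℂ^d`. -/
abbrev openBall (d : ℕ) : Set (Cd d) := Metric.ball 0 1

/-- The closed unit ball of `ℂ^d`. -/
abbrev closedBall (d : ℕ) : Set (Cd d) := Metric.closedBall 0 1

/-- The unit sphere `∂𝔹_d` of `ℂ^d`. -/
abbrev sphere (d : ℕ) : Set (Cd d) := Metric.sphere 0 1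

/-- The Hermitian inner product `⟨z, w⟩ = ∑ z_i conj (w_i)`, linear in the first variable. -/
def ip {d : ℕ} (z w : Cd d) : ℂ := ∑ i, z i * conj (w i)

/-- The kernel `1 / (1 - ⟨z, w⟩)` of the Drury-Arveson space. It is meaningful for `z`, `w` in the
open unit ball, where `⟨z, w⟩ ≠ 1`, and is used only there. -/
def holKernel {d : ℕ} (z w : Cd d) : ℂ := 1 / (1 - ip z w)

/-- The kernel `2 Re (1 / (1 - ⟨z, w⟩)) - 1` of the pluriharmonic Drury-Arveson space. -/
def plhKernel {d : ℕ} (z w : Cd d) : ℂ := ((2 * (1 / (1 - ip z w)).re - 1 : ℝ) : ℂ)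

/-- The restriction of a scalar kernel to the open unit ball, as a matrix indexed by the points of
the ball. The entry at `(z, w)` is the operator of multiplication by `K z w` on `ℂ`. -/
def kernelMatrix {d : ℕ} (K : Cd d → Cd d → ℂ) :
    Matrix (openBall d) (openBall d) (ℂ →L[ℂ] ℂ) :=
  Matrix.of fun z w => K z w • ContinuousLinearMap.id ℂ ℂ

/-! The two kernels are positive semidefinite. -/

/-- Nonnegativity of the quadratic forms of a scalar kernel. -/
def NonnegForms {d : ℕ} (K : Cd d → Cd d → ℂ) : Prop :=
  ∀ (s : Finset (openBall d)) (c : openBall d → ℂ),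
    0 ≤ (∑ x ∈ s, ∑ y ∈ s, conj (K y x * c x) * c y).re

lemma nonnegForms_feature {d : ℕ} {ι : Type} [Fintype ι] (φ : ι → Cd d → ℂ) :
    NonnegForms (fun z w => ∑ i, φ i z * conj (φ i w)) := by
  intro s c
  have h : (∑ x ∈ s, ∑ y ∈ s, conj ((∑ i, φ i y * conj (φ i x)) * c x) * c y)
      = ∑ i, (∑ x ∈ s, φ i x * conj (c x)) * conj (∑ x ∈ s, φ i x * conj (c x)) := by
    calc _ = ∑ x ∈ s, ∑ y ∈ s, ∑ i, φ i x * conj (c x) * conj (φ i y * conj (c y)) := by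
          refine Finset.sum_congr rfl fun x _ => Finset.sum_congr rfl fun y _ => ?_
          rw [map_mul, map_sum, Finset.sum_mul, Finset.sum_mul]
          refine Finset.sum_congr rfl fun i _ => ?_
          simp only [map_mul, Complex.conj_conj]
          ring
      _ = ∑ x ∈ s, ∑ i, ∑ y ∈ s, φ i x * conj (c x) * conj (φ i y * conj (c y)) :=
          Finset.sum_congr rfl fun x _ => Finset.sum_comm
      _ = ∑ i, ∑ x ∈ s, ∑ y ∈ s, φ i x * conj (c x) * conj (φ i y * conj (c y)) :=
          Finset.sum_comm
      _ = _ := by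
          refine Finset.sum_congr rfl fun i _ => ?_
          rw [map_sum, Finset.sum_mul_sum]
  rw [h, Complex.re_sum]
  refine Finset.sum_nonneg fun i _ => ?_
  rw [Complex.mul_conj]
  simpa using Complex.normSq_nonneg _

lemma nonnegForms_add {d : ℕ} {K L : Cd d → Cd d → ℂ} (hK : NonnegForms K)
    (hL : NonnegForms L) : NonnegForms (fun z w => K z w + L z w) := by
  intro s c
  have := add_nonneg (hK s c) (hL s c)
  simpa only [add_mul, map_add, Finset.sum_add_distrib, Complex.add_re] using this

lemma nonnegForms_hasSum {d : ℕ} {K : ℕ → Cd d → Cd d → ℂ} {L : Cd d → Cd d → ℂ}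
    (hK : ∀ n, NonnegForms (K n))
    (h : ∀ z ∈ openBall d, ∀ w ∈ openBall d, HasSum (fun n => K n z w) (L z w)) :
    NonnegForms L := by
  intro s c
  have hs : HasSum (fun n => (∑ x ∈ s, ∑ y ∈ s, conj (K n y x * c x) * c y))
      (∑ x ∈ s, ∑ y ∈ s, conj (L y x * c x) * c y) := by
    refine hasSum_sum fun x _ => hasSum_sum fun y _ => ?_
    have h1 := ((h y y.2 x x.2).mul_right (c x))
    have h2 := Complex.hasSum_conj'.mpr h1
    exact h2.mul_right (c y)
  exact (Complex.hasSum_re hs).nonneg fun n => hK n s c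

lemma ip_pow {d : ℕ} (n : ℕ) (z w : Cd d) :
    ip z w ^ n = ∑ p : Fin n → Fin d, (∏ j, z (p j)) * conj (∏ j, w (p j)) := by
  simp [ip, Fintype.sum_pow, Finset.prod_mul_distrib]

lemma conj_ip_pow {d : ℕ} (n : ℕ) (z w : Cd d) :
    conj (ip z w ^ n) = ∑ p : Fin n → Fin d, conj (∏ j, z (p j)) * conj (conj (∏ j, w (p j))) := by
  simp [ip_pow]

lemma ip_eq_inner {d : ℕ} (z w : Cd d) : ip z w = inner ℂ w z := by
  simp [ip, PiLp.inner_apply]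

lemma norm_ip_lt_one {d : ℕ} {z w : Cd d} (hz : z ∈ openBall d) (hw : w ∈ openBall d) :
    ‖ip z w‖ < 1 := by
  rw [ip_eq_inner]
  rw [mem_ball_zero_iff] at hz hw
  have := norm_inner_le_norm (𝕜 := ℂ) w z
  nlinarith [norm_nonneg z, norm_nonneg w]

lemma conj_ip {d : ℕ} (z w : Cd d) : conj (ip z w) = ip w z := by
  simp [ip_eq_inner]

lemma nonnegForms_holKernel (d : ℕ) : NonnegForms (holKernel (d := d)) := by
  refine nonnegForms_hasSum (K := fun n z w => ip z w ^ n) (fun n => ?_) fun z hz w hw => ?_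
  · simp only [ip_pow]
    exact nonnegForms_feature (fun (p : Fin n → Fin d) z => ∏ j, z (p j))
  · rw [holKernel, one_div]
    exact hasSum_geometric_of_norm_lt_one (norm_ip_lt_one hz hw)

lemma nonnegForms_plhKernel (d : ℕ) : NonnegForms (plhKernel (d := d)) := by
  refine nonnegForms_hasSum (K := fun n z w => ip z w ^ n + conj (ip z w ^ (n + 1)))
    (fun n => nonnegForms_add ?_ ?_) fun z hz w hw => ?_
  · simp only [ip_pow]
    exact nonnegForms_feature (fun (p : Fin n → Fin d) z => ∏ j, z (p j))
  · simp only [conj_ip_pow]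
    exact nonnegForms_feature (fun (p : Fin (n + 1) → Fin d) z => conj (∏ j, z (p j)))
  · have hlt := norm_ip_lt_one hz hw
    have h1 := hasSum_geometric_of_norm_lt_one hlt
    have h2 := Complex.hasSum_conj'.mpr (h1.mul_right (ip z w))
    have h3 := h1.add h2
    have hne : (1 : ℂ) - ip z w ≠ 0 := by
      intro h0
      rw [sub_eq_zero] at h0
      rw [← h0] at hlt
      simp at hlt
    have e1 : (1 - ip z w)⁻¹ * ip z w = (1 - ip z w)⁻¹ - 1 := by
      field_simp
      ring
    have e2 : plhKernel z w = (1 - ip z w)⁻¹ + conj ((1 - ip z w)⁻¹ * ip z w) := by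
      rw [e1, plhKernel, one_div, map_sub, map_one, ← add_sub_assoc, Complex.add_conj]
      push_cast
      ring
    rw [e2]
    simpa only [pow_succ] using h3

lemma posSemidef_kernelMatrix {d : ℕ} {K : Cd d → Cd d → ℂ} (hc : ∀ z w, conj (K z w) = K w z)
    (hK : NonnegForms K) : (kernelMatrix K).PosSemidef := by
  have key := (RKHS.posSemidef_tfae (K := kernelMatrix K)).out 0 2
  refine key.mpr (And.intro ?_ (fun vv => ?_))
  · ext z w
    have h1 : star (ContinuousLinearMap.id ℂ ℂ) = ContinuousLinearMap.id ℂ ℂ :=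
      star_one (ℂ →L[ℂ] ℂ)
    simp [kernelMatrix, Matrix.conjTranspose_apply, star_smul, hc, h1]
  · have h2 := hK vv.support vv
    have h3 : (vv.sum fun x w => vv.sum fun x' w' => inner ℂ ((kernelMatrix K x' x) w) w')
        = ∑ x ∈ vv.support, ∑ y ∈ vv.support, conj (K y x * vv x) * vv y := by
      refine Finset.sum_congr rfl fun x _ => Finset.sum_congr rfl fun y _ => ?_
      exact mul_comm _ _
    rw [h3]
    exact h2

instance posSemidef_holKernel (d : ℕ) : Fact (kernelMatrix (holKernel (d := d))).PosSemidef :=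
  ⟨posSemidef_kernelMatrix (fun z w => by simp [holKernel, conj_ip]) (nonnegForms_holKernel d)⟩

instance posSemidef_plhKernel (d : ℕ) : Fact (kernelMatrix (plhKernel (d := d))).PosSemidef :=
  ⟨posSemidef_kernelMatrix (fun z w => by
    have h : (1 / (1 - ip w z)) = conj (1 / (1 - ip z w)) := by simp [conj_ip]
    rw [plhKernel, plhKernel, h, Complex.conj_re, Complex.conj_ofReal]) (nonnegForms_plhKernel d)⟩

/-- The Drury-Arveson space `H^2_d`: the reproducing kernel Hilbert space on the open unit ball of
`ℂ^d` with kernel `1 / (1 - ⟨z, w⟩)`. Its elements are functions on the ball. -/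
abbrev Hol (d : ℕ) : Type := RKHS.OfKernel (kernelMatrix (holKernel (d := d)))

/-- The pluriharmonic Drury-Arveson space `h^2_d`: the reproducing kernel Hilbert space on the open
unit ball of `ℂ^d` with kernel `2 Re (1 / (1 - ⟨z, w⟩)) - 1`. -/
abbrev Plh (d : ℕ) : Type := RKHS.OfKernel (kernelMatrix (plhKernel (d := d)))

/-- The energy `sup_{0 ≤ r < 1} ∫ ∫ Re K(rz, rw) dμ(w) dμ(z)` of a positive measure `μ`, used for
probability measures on the closed ball. For the kernels above, the double integrals of such
measures are nonnegative (they even increase with `r`), so `ENNReal.ofReal` loses nothing. -/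
def energy {d : ℕ} (K : Cd d → Cd d → ℂ) (μ : Measure (Cd d)) : ℝ≥0∞ :=
  ⨆ r ∈ Ico (0 : ℝ) 1, ENNReal.ofReal (∫ z, ∫ w, (K (r • z) (r • w)).re ∂μ ∂μ)

/-- The capacity of a compact set `F`: the supremum of `1 / energy μ` over all Borel probability
measures `μ` supported on `F`. -/
def compactCap {d : ℕ} (K : Cd d → Cd d → ℂ) (F : Set (Cd d)) : ℝ≥0∞ :=
  ⨆ (μ : Measure (Cd d)) (_ : IsProbabilityMeasure μ) (_ : μ Fᶜ = 0), (energy K μ)⁻¹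

/-- The inner capacity of a subset `E` of the closed unit ball. -/
def innerCap {d : ℕ} (K : Cd d → Cd d → ℂ) (E : Set (Cd d)) : ℝ≥0∞ :=
  ⨆ (F : Set (Cd d)) (_ : IsCompact F) (_ : F ⊆ E), compactCap K F

/-- The outer capacity of a subset `E` of the closed unit ball: the infimum of the capacities of
the relatively open subsets `U ∩ closedBall d` of the closed ball that contain `E`. -/
def outerCap {d : ℕ} (K : Cd d → Cd d → ℂ) (E : Set (Cd d)) : ℝ≥0∞ :=
  ⨅ (U : Set (Cd d)) (_ : IsOpen U) (_ : E ⊆ U), innerCap K (U ∩ closedBall d)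

/-- The Korányi approach region `D_α(ζ) = {z ∈ 𝔹_d : |1 - ⟨z, ζ⟩| < (α / 2) (1 - ‖z‖²)}`. -/
def koranyiRegion {d : ℕ} (α : ℝ) (ζ : Cd d) : Set (openBall d) :=
  {z | ‖1 - ip (z : Cd d) ζ‖ < α / 2 * (1 - ‖(z : Cd d)‖ ^ 2)}

/-- `f` has Korányi limit `l` at `ζ`: for every `α > 1`, `f z` tends to `l` as `z` tends to `ζ`
within `D_α(ζ)`. -/
def HasKoranyiLimit {d : ℕ} (f : openBall d → ℂ) (ζ : Cd d) (l : ℂ) : Prop :=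
  ∀ α : ℝ, 1 < α →
    Tendsto f (comap ((↑) : openBall d → Cd d) (𝓝 ζ) ⊓ 𝓟 (koranyiRegion α ζ)) (𝓝 l)

end DruryArveson

end

/-!
The proof is the same for both spaces. It uses only the reproducing property and two facts about
the real part of the kernel: it is nonnegative on the ball, and it satisfies a Harnack inequality
along Korányi regions (`HarnackKernel`). The latter holds because `2 Re (1 / (1 - u)) - 1` is the
Poisson kernel `(1 - |u|²) / |1 - u|²`, and because `|1 - ⟨z, w⟩|` satisfies a quasi-triangle
inequality (`norm_one_sub_ip_le`).

The heart of the matter is a capacitary weak-type inequality for the Korányi maximal function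
(`exists_measure_koranyiShadow_le`): if `μ` is a measure on the closed ball and `U` is the open set
of the points whose Korányi region contains a point `z` with `|h(z)| > t`, then
`μ(U) ≤ C ‖h‖ 𝓔(μ)^{1/2} / t`. The kernel does not increase radially, so there is no pointwise
domination of the maximal function, and a `T T*` argument takes its place
(`norm_sum_kerAt_le`). Divide a compact part of `U` into finitely many sets `A_i` that share a
point `z_i`, and let `g = ∑ μ(A_i) K(·, z_i)`, so that `t μ(⋃ A_i) ≤ Re ⟨h, g⟩ ≤ ‖h‖ ‖g‖`. In
`‖g‖² = ∑∑ μ(A_i) μ(A_j) Re K(z_i, z_j)` consider the pairs with `|z_i| ≤ |z_j|`: by Harnack,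
`Re K(z_i, z_j)` is at most `C` times `Re K(z_i, s η)` for all `η ∈ A_j` and `s` close to `1`. Hence
`‖g‖² ≤ 2 C Re ⟨g, G⟩ ≤ 2 C ‖g‖ ‖G‖`, where `G = ∫ K(·, s η) dμ(η)` is the potential of `μ`, and
`‖G‖²` is a double integral in the definition of the energy.

Density of the kernel functions, which extend continuously to the sphere, then gives Korányi limits
off a limsup of such sets `U`. Finally `1 / 𝓔(μ)` for the kernel of `H^2_d` is at most twice that
for the kernel of `h^2_d`, which compares the two outer capacities.
-/

noncomputable section

namespace DruryArveson

variable {d : ℕ}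

/-! ### The quasi-metric `|1 - ⟨z, w⟩|` and the Harnack inequality -/

lemma norm_ip_le (z w : Cd d) : ‖ip z w‖ ≤ ‖z‖ * ‖w‖ := by
  rw [ip_eq_inner, mul_comm]
  exact norm_inner_le_norm w z

lemma norm_one_sub_ip_comm (z w : Cd d) : ‖1 - ip z w‖ = ‖1 - ip w z‖ := by
  rw [← conj_ip z w, ← RCLike.norm_conj (1 - ip z w)]
  simp

lemma one_sub_norm_le {a b : Cd d} (hb : ‖b‖ ≤ 1) : 1 - ‖a‖ ≤ ‖1 - ip a b‖ := by
  have h1 := norm_ip_le a b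
  have h2 := norm_sub_norm_le (1 : ℂ) (ip a b)
  rw [norm_one] at h2
  nlinarith [norm_nonneg a, norm_nonneg b]

lemma norm_sub_sq_le {a b : Cd d} (ha : ‖a‖ ≤ 1) (hb : ‖b‖ ≤ 1) :
    ‖a - b‖ ^ 2 ≤ 2 * ‖1 - ip a b‖ := by
  have h1 := @norm_sub_sq ℂ (Cd d) _ _ _ a b
  have h2 : (1 - ip a b).re ≤ ‖1 - ip a b‖ := Complex.re_le_norm _
  have h3 : (ip a b).re = RCLike.re (inner ℂ a b) := by
    rw [ip_eq_inner]; exact inner_re_symm (𝕜 := ℂ) _ _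
  simp only [Complex.sub_re, Complex.one_re, h3] at h2
  nlinarith [norm_nonneg a, norm_nonneg b]

/-- The nonisotropic quantity `|1 - ⟨a, b⟩|` satisfies a quasi-triangle inequality on the closed
ball. -/
lemma norm_one_sub_ip_le {a b c : Cd d} (ha : ‖a‖ ≤ 1) (hb : ‖b‖ ≤ 1) (hc : ‖c‖ ≤ 1) :
    ‖1 - ip a c‖ ≤ 4 * (‖1 - ip a b‖ + ‖1 - ip b c‖) := by
  -- expand `⟨a - b, c - b⟩`; all error terms are controlled by the two quantities on the right
  have e : 1 - ip a c = (1 - ip a b) + (1 - ip b c) - (1 - ip b b) - ip (a - b) (c - b) := by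
    simp only [ip_eq_inner, inner_sub_left, inner_sub_right]
    ring
  have hbb : ‖1 - ip b b‖ ≤ 2 * ‖1 - ip a b‖ := by
    have h1 : (1 : ℂ) - ip b b = ((1 - ‖b‖ ^ 2 : ℝ) : ℂ) := by
      rw [ip_eq_inner, inner_self_eq_norm_sq_to_K]; simp
    have h2 := one_sub_norm_le (a := b) ha
    rw [norm_one_sub_ip_comm] at h2
    rw [h1, Complex.norm_real, Real.norm_of_nonneg (by nlinarith [norm_nonneg b])]
    nlinarith [norm_nonneg b]
  have hp : ‖ip (a - b) (c - b)‖ ≤ ‖1 - ip a b‖ + ‖1 - ip b c‖ := by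
    have h1 := norm_ip_le (a - b) (c - b)
    have h2 := norm_sub_sq_le ha hb
    have h3 := norm_sub_sq_le hc hb
    rw [norm_one_sub_ip_comm c b] at h3
    nlinarith [sq_nonneg (‖a - b‖ - ‖c - b‖)]
  rw [e]
  have n1 := norm_sub_le ((1 - ip a b) + (1 - ip b c) - (1 - ip b b)) (ip (a - b) (c - b))
  have n2 := norm_sub_le ((1 - ip a b) + (1 - ip b c)) (1 - ip b b)
  have n3 := norm_add_le (1 - ip a b) (1 - ip b c)
  linarith [norm_nonneg (1 - ip a b), norm_nonneg (1 - ip b c)]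

/-- The real part of `1 / (1 - u)` is an affine function of the Poisson kernel. -/
lemma two_mul_re_sub_one {u : ℂ} (hu : u ≠ 1) :
    2 * (1 / (1 - u)).re - 1 = (1 - ‖u‖ ^ 2) / ‖1 - u‖ ^ 2 := by
  have h0 : Complex.normSq (1 - u) ≠ 0 := by
    rw [Ne, Complex.normSq_eq_zero, sub_eq_zero]
    exact fun h => hu h.symm
  rw [one_div, Complex.inv_re, ← Complex.normSq_eq_norm_sq, ← Complex.normSq_eq_norm_sq]
  field_simp
  simp [Complex.normSq_apply]
  ring

/-- If `|z| ≤ |w| ≤ s` and `w` lies in the Korányi region of `η`, then `w` may be replaced by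
`s η` in the quantities `|1 - ⟨z, w⟩|` and `1 - |⟨z, w⟩|`, at the cost of a constant. -/
lemma norm_one_sub_ip_compare {α s : ℝ} {z w η : Cd d}
    (hzw : ‖z‖ ≤ ‖w‖) (hws : ‖w‖ ≤ s) (hs : s < 1) (hη : ‖η‖ ≤ 1)
    (hα : ‖1 - ip w η‖ < α / 2 * (1 - ‖w‖ ^ 2)) :
    ‖1 - ip z (s • η)‖ ≤ (12 + 4 * α) * ‖1 - ip z w‖ ∧
      1 - ‖ip z w‖ ≤ (12 + 4 * α) * (1 - ‖ip z (s • η)‖) := by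
  have hs0 : 0 ≤ s := (norm_nonneg w).trans hws
  have hw1 : ‖w‖ ≤ 1 := hws.trans hs.le
  have hz1 : ‖z‖ ≤ 1 := hzw.trans hw1
  have hsη : ‖s • η‖ ≤ 1 := by
    rw [norm_smul, Real.norm_of_nonneg hs0]
    nlinarith [norm_nonneg η]
  have hw0 := norm_nonneg w
  have hδ : 1 - ‖w‖ ≤ 1 - ‖w‖ ^ 2 ∧ 1 - ‖w‖ ^ 2 ≤ 2 * (1 - ‖w‖) := by
    constructor <;> nlinarith
  have hα0 : 0 ≤ α := by
    by_contra h
    nlinarith [norm_nonneg (1 - ip w η), hδ.1]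
  have hws' : ‖1 - ip w (s • η)‖ ≤ (1 + α / 2) * (1 - ‖w‖ ^ 2) := by
    have e : 1 - ip w (s • η) = ((1 - s : ℝ) : ℂ) + (s : ℂ) * (1 - ip w η) := by
      have : ip w (s • η) = s * ip w η := by
        simp [ip, Finset.mul_sum]
        exact Finset.sum_congr rfl fun i _ => by ring
      rw [this]; push_cast; ring
    have h1 := norm_add_le ((1 - s : ℝ) : ℂ) ((s : ℂ) * (1 - ip w η))
    rw [norm_mul, Complex.norm_real, Complex.norm_real, Real.norm_of_nonneg hs0,
      Real.norm_of_nonneg (by linarith : 0 ≤ 1 - s)] at h1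
    rw [e]
    nlinarith [norm_nonneg (1 - ip w η)]
  have key : 4 * (1 + α / 2) * (1 - ‖w‖ ^ 2) ≤ (8 + 4 * α) * (1 - ‖w‖) := by nlinarith
  constructor
  · have h1 := norm_one_sub_ip_le hz1 hw1 hsη
    have h2 : 1 - ‖w‖ ≤ ‖1 - ip z w‖ := by
      have := one_sub_norm_le (a := z) hw1
      linarith
    nlinarith
  · -- rotate so that `⟨z, s η⟩` becomes nonnegative
    obtain ⟨e, he, hev⟩ : ∃ e : ℂ, ‖e‖ = 1 ∧ e * ip z (s • η) = ‖ip z (s • η)‖ := by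
      obtain ⟨e, he, h⟩ := RCLike.exists_norm_eq_mul_self (ip z (s • η))
      exact ⟨e, he, h.symm⟩
    have hsm : ∀ x y : Cd d, ip (e • x) y = e * ip x y := fun x y => by
      simp [ip_eq_inner]
    have h1 := norm_one_sub_ip_le (a := e • z) (by rwa [norm_smul, he, one_mul]) hsη hw1
    rw [hsm, hsm, hev, norm_one_sub_ip_comm (s • η) w] at h1
    have h2 : ‖ip z (s • η)‖ ≤ ‖z‖ := by
      have := norm_ip_le z (s • η)
      nlinarith [norm_nonneg z, norm_nonneg (s • η)]
    have h3 : ‖(1 : ℂ) - (‖ip z (s • η)‖ : ℂ)‖ = 1 - ‖ip z (s • η)‖ := by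
      rw [← Complex.ofReal_one, ← Complex.ofReal_sub, Complex.norm_real, Real.norm_of_nonneg]
      linarith
    have h4 : 1 - ‖ip z w‖ ≤ ‖1 - e * ip z w‖ := by
      have := norm_sub_norm_le (1 : ℂ) (e * ip z w)
      rwa [norm_one, norm_mul, he, one_mul] at this
    rw [h3] at h1
    nlinarith

lemma ip_ne_one {z w : Cd d} (hz : ‖z‖ ≤ 1) (hw : ‖w‖ < 1) : ip z w ≠ 1 := by
  intro h
  have := norm_ip_le z w
  rw [h, norm_one] at this
  nlinarith [norm_nonneg z, norm_nonneg w]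

lemma two_mul_re_sub_one_nonneg {z w : Cd d} (hz : ‖z‖ ≤ 1) (hw : ‖w‖ < 1) :
    0 ≤ 2 * (1 / (1 - ip z w)).re - 1 := by
  rw [two_mul_re_sub_one (ip_ne_one hz hw)]
  have h1 := norm_ip_le z w
  have h2 : ‖ip z w‖ ≤ 1 := by nlinarith [norm_nonneg z, norm_nonneg w]
  have h3 : 0 ≤ 1 - ‖ip z w‖ ^ 2 := by nlinarith [norm_nonneg (ip z w)]
  positivity

/-- Harnack's inequality for the kernel of the pluriharmonic space. -/
lemma poisson_harnack {α s : ℝ} {z w η : Cd d}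
    (hzw : ‖z‖ ≤ ‖w‖) (hws : ‖w‖ ≤ s) (hs : s < 1) (hη : ‖η‖ ≤ 1)
    (hα : ‖1 - ip w η‖ < α / 2 * (1 - ‖w‖ ^ 2)) :
    2 * (1 / (1 - ip z w)).re - 1
      ≤ 2 * (12 + 4 * |α|) ^ 3 * (2 * (1 / (1 - ip z (s • η))).re - 1) := by
  have hs0 : 0 ≤ s := (norm_nonneg w).trans hws
  have hz1 : ‖z‖ ≤ 1 := hzw.trans (hws.trans hs.le)
  have hsη : ‖s • η‖ < 1 := by
    rw [norm_smul, Real.norm_of_nonneg hs0]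
    nlinarith [norm_nonneg η]
  have hu := ip_ne_one hz1 (hws.trans_lt hs)
  have hv := ip_ne_one hz1 hsη
  obtain ⟨h1, h2⟩ := norm_one_sub_ip_compare hzw hws hs hη
    (hα.trans_le (by gcongr; · nlinarith [norm_nonneg w]
                     · exact le_abs_self α : _ ≤ |α| / 2 * (1 - ‖w‖ ^ 2)))
  rw [two_mul_re_sub_one hu, two_mul_re_sub_one hv]
  have hu' : 0 < ‖1 - ip z w‖ := norm_pos_iff.2 (sub_ne_zero.2 hu.symm)
  have hv' : 0 < ‖1 - ip z (s • η)‖ := norm_pos_iff.2 (sub_ne_zero.2 hv.symm)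
  have hM : 0 < 12 + 4 * |α| := by positivity
  generalize 12 + 4 * |α| = M at *
  have hb := norm_ip_le z (s • η)
  have hb' := norm_ip_le z w
  have hvn : ‖ip z (s • η)‖ ≤ 1 := by nlinarith [norm_nonneg z, norm_nonneg (s • η)]
  have hun : ‖ip z w‖ ≤ 1 := by nlinarith [norm_nonneg z, norm_nonneg w]
  have h3 : 1 - ‖ip z w‖ ^ 2 ≤ 2 * M * (1 - ‖ip z (s • η)‖ ^ 2) := by
    have e1 : 1 - ‖ip z w‖ ^ 2 ≤ 2 * (1 - ‖ip z w‖) := by nlinarith [norm_nonneg (ip z w)]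
    have e2 : 1 - ‖ip z (s • η)‖ ≤ 1 - ‖ip z (s • η)‖ ^ 2 := by
      nlinarith [norm_nonneg (ip z (s • η))]
    nlinarith
  have h4 : ‖1 - ip z (s • η)‖ ^ 2 ≤ M ^ 2 * ‖1 - ip z w‖ ^ 2 := by
    rw [← mul_pow]; gcongr
  have h5 : 0 ≤ 1 - ‖ip z (s • η)‖ ^ 2 := by nlinarith [norm_nonneg (ip z (s • η))]
  rw [← mul_div_assoc, div_le_div_iff₀ (by positivity) (by positivity)]
  calc _ ≤ (2 * M * (1 - ‖ip z (s • η)‖ ^ 2)) * (M ^ 2 * ‖1 - ip z w‖ ^ 2) := by gcongr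
    _ = _ := by ring

/-- The Harnack inequality with constant `C` along Korányi regions of aperture `α`: the real part
of the kernel grows by at most the factor `C` when the second argument moves from a point `w` of
the region of `η` to the point `s η`, provided that `|z| ≤ |w| ≤ s < 1`. The order of the moduli is
needed: for `d = 1` and the Poisson kernel there is no such bound when `z` is closer to the circle
than `w`. -/
def HarnackBound (K : Cd d → Cd d → ℂ) (α C : ℝ) : Prop :=
  ∀ ⦃s : ℝ⦄ ⦃z w η : Cd d⦄, ‖z‖ ≤ ‖w‖ → ‖w‖ ≤ s → s < 1 → ‖η‖ ≤ 1 →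
    ‖1 - ip w η‖ < α / 2 * (1 - ‖w‖ ^ 2) → (K z w).re ≤ C * (K z (s • η)).re

/-- The properties of a scalar kernel on the ball on which the capacitary estimates rest: its real
part is nonnegative, it is continuous off the pairs with `⟨z, w⟩ = 1`, and its real part satisfies
a Harnack inequality along Korányi regions. -/
structure HarnackKernel (K : Cd d → Cd d → ℂ) : Prop where
  re_nonneg : ∀ {z w : Cd d}, ‖z‖ < 1 → ‖w‖ < 1 → 0 ≤ (K z w).re
  continuousAt : ∀ {z w : Cd d}, ip z w ≠ 1 →
    ContinuousAt (fun p : Cd d × Cd d => K p.1 p.2) (z, w)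
  harnack : ∀ α : ℝ, ∃ C : ℝ, 0 < C ∧ HarnackBound K α C

lemma continuous_ip : Continuous fun p : Cd d × Cd d => ip p.1 p.2 := by
  simp only [ip_eq_inner]
  fun_prop

lemma continuousAt_holKernel {z w : Cd d} (h : ip z w ≠ 1) :
    ContinuousAt (fun p : Cd d × Cd d => holKernel p.1 p.2) (z, w) := by
  unfold holKernel
  exact continuousAt_const.div (continuousAt_const.sub continuous_ip.continuousAt)
    (sub_ne_zero.2 h.symm)

lemma harnackKernel_plhKernel : HarnackKernel (plhKernel (d := d)) where
  re_nonneg hz hw := by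
    rw [plhKernel, Complex.ofReal_re]
    exact two_mul_re_sub_one_nonneg hz.le hw
  continuousAt h := by
    unfold plhKernel
    have h1 := continuousAt_holKernel h
    exact Complex.continuous_ofReal.continuousAt.comp
      (((Complex.continuous_re.continuousAt.comp h1).const_mul 2).sub continuousAt_const)
  harnack α := by
    refine ⟨2 * (12 + 4 * |α|) ^ 3, by positivity, fun s z w η h1 h2 h3 h4 h5 => ?_⟩
    simp only [plhKernel, Complex.ofReal_re]
    exact poisson_harnack h1 h2 h3 h4 h5

lemma harnackKernel_holKernel : HarnackKernel (holKernel (d := d)) where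
  re_nonneg hz hw := by
    have := two_mul_re_sub_one_nonneg hz.le hw
    rw [holKernel]; linarith
  continuousAt h := continuousAt_holKernel h
  harnack α := by
    refine ⟨2 * (12 + 4 * |α|) ^ 3, by positivity, fun s z w η h1 h2 h3 h4 h5 => ?_⟩
    have h6 := poisson_harnack h1 h2 h3 h4 h5
    -- `Re (1 / (1 - u))` is half of `1` plus the Poisson kernel, and the constant is at least `1`
    have h7 : 1 ≤ 2 * (12 + 4 * |α|) ^ 3 := by
      have : (1 : ℝ) ≤ (12 + 4 * |α|) ^ 3 := one_le_pow₀ (by linarith [abs_nonneg α])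
      linarith
    simp only [holKernel]
    linarith

/-! ### Potentials of measures and the `T T*` estimate -/

section RKHS

variable {H : Type*} [NormedAddCommGroup H] [InnerProductSpace ℂ H] [CompleteSpace H]
  [RKHS ℂ H (openBall d) ℂ] {K : Cd d → Cd d → ℂ}

variable (H) in
/-- The reproducing kernel function `K(·, w)` as an element of the space. -/
def kerAt (w : openBall d) : H := RKHS.kerFun H w 1

lemma inner_kerAt_left (w : openBall d) (f : H) : inner ℂ (kerAt H w) f = f w := by
  rw [kerAt, RKHS.kerFun_inner]; simp

lemma kerAt_apply (hH : RKHS.kernel H = kernelMatrix K) (z w : openBall d) :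
    (kerAt H w : H) z = K z w := by
  rw [kerAt, RKHS.kerFun_apply, hH]; simp [kernelMatrix]

lemma inner_kerAt_kerAt (hH : RKHS.kernel H = kernelMatrix K) (z w : openBall d) :
    inner ℂ (kerAt H z) (kerAt H w) = K z w := by
  rw [inner_kerAt_left, kerAt_apply hH]

lemma kernel_re_symm (hH : RKHS.kernel H = kernelMatrix K) (z w : openBall d) :
    (K z w).re = (K w z).re := by
  rw [← inner_kerAt_kerAt hH, ← inner_kerAt_kerAt hH]
  exact inner_re_symm (𝕜 := ℂ) _ _

lemma continuous_kerAt (hH : RKHS.kernel H = kernelMatrix K) (hK : HarnackKernel K) :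
    Continuous (kerAt H : openBall d → H) := by
  rw [continuous_iff_continuousAt]
  intro a
  rw [ContinuousAt, tendsto_iff_norm_sub_tendsto_zero]
  have e : ∀ w : openBall d, ‖kerAt H w - kerAt H a‖ =
      √((K w w).re - 2 * (K w a).re + (K a a).re) := by
    intro w
    rw [← inner_kerAt_kerAt hH, ← inner_kerAt_kerAt hH, ← inner_kerAt_kerAt hH]
    have h1 := @norm_sub_sq ℂ H _ _ _ (kerAt H w) (kerAt H a)
    rw [norm_sq_eq_re_inner (𝕜 := ℂ) (kerAt H w), norm_sq_eq_re_inner (𝕜 := ℂ) (kerAt H a)] at h1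
    rw [← Real.sqrt_sq (norm_nonneg (kerAt H w - kerAt H a)), h1]
    rfl
  have hne : ip (a : Cd d) a ≠ 1 :=
    ip_ne_one (mem_ball_zero_iff.1 a.2).le (mem_ball_zero_iff.1 a.2)
  have hc := hK.continuousAt hne
  have t1 : Tendsto (fun w : openBall d => K w w) (𝓝 a) (𝓝 (K a a)) :=
    hc.tendsto.comp ((continuous_subtype_val.prodMk continuous_subtype_val).tendsto a)
  have t2 : Tendsto (fun w : openBall d => K w a) (𝓝 a) (𝓝 (K a a)) :=
    hc.tendsto.comp ((continuous_subtype_val.prodMk continuous_const).tendsto a)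
  have t3 := (((Complex.continuous_re.tendsto _).comp t1).sub
    (((Complex.continuous_re.tendsto _).comp t2).const_mul 2)).add_const (K a a).re
  have t4 := (Real.continuous_sqrt.tendsto _).comp t3
  rw [show (K a a).re - 2 * (K a a).re + (K a a).re = 0 by ring, Real.sqrt_zero] at t4
  exact t4.congr fun w => (e w).symm

variable (H) in
/-- The kernel function at the point `s η`, for `η` in the closed ball and `0 ≤ s < 1`; it is `0`
where `s η` is not in the open ball. -/
def dilKer (s : ℝ) (η : Cd d) : H :=
  open Classical in if h : s • η ∈ openBall d then kerAt H ⟨s • η, h⟩ else 0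

lemma smul_mem_openBall {s : ℝ} (hs : s ∈ Ico (0 : ℝ) 1) {η : Cd d} (hη : η ∈ closedBall d) :
    s • η ∈ openBall d := by
  rw [mem_closedBall_zero_iff] at hη
  rw [mem_ball_zero_iff, norm_smul, Real.norm_of_nonneg hs.1]
  nlinarith [norm_nonneg η, hs.1, hs.2]

lemma dilKer_eq {s : ℝ} (hs : s ∈ Ico (0 : ℝ) 1) {η : Cd d} (hη : η ∈ closedBall d) :
    dilKer H s η = kerAt H ⟨s • η, smul_mem_openBall hs hη⟩ := by
  rw [dilKer, dif_pos]

lemma continuousOn_dilKer (hH : RKHS.kernel H = kernelMatrix K) (hK : HarnackKernel K)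
    {s : ℝ} (hs : s ∈ Ico (0 : ℝ) 1) : ContinuousOn (dilKer H s) (closedBall d) := by
  rw [continuousOn_iff_continuous_domRestrict]
  have e : (closedBall d).domRestrict (dilKer H s) =
      fun η : closedBall d => kerAt H ⟨s • (η : Cd d), smul_mem_openBall hs η.2⟩ := by
    ext1 η
    exact dilKer_eq hs η.2
  rw [e]
  exact (continuous_kerAt hH hK).comp (by fun_prop)

variable {μ : Measure (Cd d)}

lemma ae_mem_closedBall (hμ : μ (closedBall d)ᶜ = 0) : ∀ᵐ η ∂μ, η ∈ closedBall d :=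
  measure_eq_zero_iff_ae_notMem.1 hμ |>.mono fun η h => by simpa using h

variable [IsFiniteMeasure μ]

lemma integrable_of_continuousOn_closedBall {E : Type*} [NormedAddCommGroup E]
    (hμ : μ (closedBall d)ᶜ = 0) {F : Cd d → E} (hF : ContinuousOn F (closedBall d)) :
    Integrable F μ := by
  have h := hF.integrableOn_compact (μ := μ) (isCompact_closedBall _ _)
  rwa [IntegrableOn, Measure.restrict_eq_self_of_ae_mem (ae_mem_closedBall hμ)] at h

lemma integrable_kernel_re (hH : RKHS.kernel H = kernelMatrix K) (hK : HarnackKernel K)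
    {s : ℝ} (hs : s ∈ Ico (0 : ℝ) 1) (hμ : μ (closedBall d)ᶜ = 0) {z : Cd d}
    (hz : z ∈ closedBall d) : Integrable (fun w => (K (s • z) (s • w)).re) μ := by
  have hint := integrable_of_continuousOn_closedBall hμ (continuousOn_dilKer hH hK hs)
  refine (hint.const_inner (𝕜 := ℂ) (dilKer H s z)).re.congr
    ((ae_mem_closedBall hμ).mono fun w hw => ?_)
  simp only
  rw [dilKer_eq hs hz, dilKer_eq hs hw, inner_kerAt_kerAt hH]
  rfl

lemma integral_kernel_re (hH : RKHS.kernel H = kernelMatrix K) (hK : HarnackKernel K)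
    {s : ℝ} (hs : s ∈ Ico (0 : ℝ) 1) (hμ : μ (closedBall d)ᶜ = 0) {z : Cd d}
    (hz : z ∈ closedBall d) : ∫ w, (K (s • z) (s • w)).re ∂μ =
      RCLike.re (inner ℂ (∫ η, dilKer H s η ∂μ) (dilKer H s z)) := by
  have hint := integrable_of_continuousOn_closedBall hμ (continuousOn_dilKer hH hK hs)
  rw [inner_re_symm (𝕜 := ℂ), ← integral_inner hint, ← integral_re (hint.const_inner _)]
  refine integral_congr_ae ((ae_mem_closedBall hμ).mono fun w hw => ?_)
  simp only
  rw [dilKer_eq hs hz, dilKer_eq hs hw, inner_kerAt_kerAt hH]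
  rfl

lemma integrable_integral_kernel_re (hH : RKHS.kernel H = kernelMatrix K)
    (hK : HarnackKernel K) {s : ℝ} (hs : s ∈ Ico (0 : ℝ) 1) (hμ : μ (closedBall d)ᶜ = 0) :
    Integrable (fun z => ∫ w, (K (s • z) (s • w)).re ∂μ) μ := by
  have hint := integrable_of_continuousOn_closedBall hμ (continuousOn_dilKer hH hK hs)
  exact (hint.const_inner (𝕜 := ℂ) _).re.congr
    ((ae_mem_closedBall hμ).mono fun z hz => (integral_kernel_re hH hK hs hμ hz).symm)

/-- The double integral in the energy is the squared norm of the potential `∫ K(·, s η) dμ(η)`. -/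
lemma integral_integral_kernel_re (hH : RKHS.kernel H = kernelMatrix K) (hK : HarnackKernel K)
    {s : ℝ} (hs : s ∈ Ico (0 : ℝ) 1) (hμ : μ (closedBall d)ᶜ = 0) :
    ∫ z, ∫ w, (K (s • z) (s • w)).re ∂μ ∂μ = ‖∫ η, dilKer H s η ∂μ‖ ^ 2 := by
  have hint := integrable_of_continuousOn_closedBall hμ (continuousOn_dilKer hH hK hs)
  rw [integral_congr_ae ((ae_mem_closedBall hμ).mono fun z hz =>
    integral_kernel_re hH hK hs hμ hz), norm_sq_eq_re_inner (𝕜 := ℂ),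
    integral_re (hint.const_inner _), integral_inner hint]

lemma ofReal_norm_integral_dilKer_sq_le (hH : RKHS.kernel H = kernelMatrix K)
    (hK : HarnackKernel K) {s : ℝ} (hs : s ∈ Ico (0 : ℝ) 1) (hμ : μ (closedBall d)ᶜ = 0) :
    ENNReal.ofReal (‖∫ η, dilKer H s η ∂μ‖ ^ 2) ≤ energy K μ := by
  rw [← integral_integral_kernel_re hH hK hs hμ]
  exact le_iSup₂ (f := fun r (_ : r ∈ Ico (0 : ℝ) 1) =>
    ENNReal.ofReal (∫ z, ∫ w, (K (r • z) (r • w)).re ∂μ ∂μ)) s hs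

/-- The `T T*` estimate behind the capacitary weak-type inequality: replacing `μ` on each of the
disjoint sets `A i` by a point mass at a point `z i` of the Korányi regions of all points of `A i`
does not increase the norm of the potential by more than a constant. -/
lemma norm_sum_kerAt_le (hH : RKHS.kernel H = kernelMatrix K) (hK : HarnackKernel K)
    {α C : ℝ} (hC0 : 0 < C) (hC : HarnackBound K α C)
    {s : ℝ} (hs : s ∈ Ico (0 : ℝ) 1) (hμ : μ (closedBall d)ᶜ = 0)
    {ι : Type*} [Fintype ι] {z : ι → openBall d} (hzs : ∀ i, ‖(z i : Cd d)‖ ≤ s)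
    {A : ι → Set (Cd d)} (hAm : ∀ i, MeasurableSet (A i))
    (hAd : Pairwise (Function.onFun Disjoint A))
    (hA : ∀ i, ∀ η ∈ A i, η ∈ closedBall d ∧ z i ∈ koranyiRegion α η) :
    ‖∑ i, (μ.real (A i) : ℂ) • kerAt H (z i)‖ ≤ 2 * C * ‖∫ η, dilKer H s η ∂μ‖ := by
  set G : H := ∫ η, dilKer H s η ∂μ with hG
  set g : H := ∑ i, (μ.real (A i) : ℂ) • kerAt H (z i) with hg
  have hint := integrable_of_continuousOn_closedBall hμ (continuousOn_dilKer hH hK hs)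
  set p : ι → Cd d → ℝ := fun i η => RCLike.re (inner ℂ (kerAt H (z i)) (dilKer H s η)) with hp
  have hpK : ∀ i, ∀ η ∈ closedBall d, p i η = (K (z i) (s • η)).re := by
    intro i η hη
    simp only [hp]
    rw [dilKer_eq hs hη, inner_kerAt_kerAt hH]
    rfl
  have hpi : ∀ i, Integrable (p i) μ := fun i => (hint.const_inner _).re
  have hp0 : ∀ i, ∀ η ∈ closedBall d, 0 ≤ p i η := by
    intro i η hη
    rw [hpK i η hη]
    exact hK.re_nonneg (mem_ball_zero_iff.1 (z i).2)
      (mem_ball_zero_iff.1 (smul_mem_openBall hs hη))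
  have hp0' : ∀ i, 0 ≤ᵐ[μ] p i := fun i => (ae_mem_closedBall hμ).mono (hp0 i)
  -- `b i j` is the `(i, j)` term of `‖g‖ ^ 2` with the point mass at `z j` spread back over `A j`
  set b : ι → ι → ℝ := fun i j => μ.real (A i) * (C * ∫ η in A j, p i η ∂μ) with hb
  have hb0 : ∀ i j, 0 ≤ b i j := fun i j =>
    mul_nonneg measureReal_nonneg (mul_nonneg hC0.le
      (setIntegral_nonneg (hAm j) fun η hη => hp0 i η (hA j η hη).1))
  have hle : ∀ i j, ‖(z i : Cd d)‖ ≤ ‖(z j : Cd d)‖ →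
      μ.real (A i) * (μ.real (A j) * (K (z i) (z j)).re) ≤ b i j := by
    intro i j hij
    refine mul_le_mul_of_nonneg_left ?_ measureReal_nonneg
    rw [← integral_const_mul, ← smul_eq_mul, ← setIntegral_const]
    refine setIntegral_mono_on (by simp) ((hpi i).const_mul C).integrableOn (hAm j)
      fun η hη => ?_
    rw [hpK i η (hA j η hη).1]
    exact hC hij (hzs j) hs.2 (mem_closedBall_zero_iff.1 (hA j η hη).1) (hA j η hη).2
  -- Harnack applies to one of the two orders of `(i, j)`; the other term is nonnegative
  have hle' : ∀ i j, μ.real (A i) * (μ.real (A j) * (K (z i) (z j)).re) ≤ b i j + b j i := by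
    intro i j
    rcases le_total ‖(z i : Cd d)‖ ‖(z j : Cd d)‖ with h | h
    · exact (hle i j h).trans (le_add_of_nonneg_right (hb0 j i))
    · have h1 := hle j i h
      rw [kernel_re_symm hH] at h1
      linarith [hb0 i j]
  have hgg : ‖g‖ ^ 2 = ∑ i, ∑ j, μ.real (A i) * (μ.real (A j) * (K (z i) (z j)).re) := by
    rw [norm_sq_eq_re_inner (𝕜 := ℂ), hg, sum_inner, map_sum]
    refine Finset.sum_congr rfl fun i _ => ?_
    rw [inner_sum, map_sum]
    refine Finset.sum_congr rfl fun j _ => ?_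
    rw [inner_smul_left, inner_smul_right, inner_kerAt_kerAt hH]
    simp
  have hsum : ∑ i, ∑ j, b i j ≤ C * RCLike.re (inner ℂ g G) := by
    rw [hg, sum_inner, map_sum, Finset.mul_sum]
    refine Finset.sum_le_sum fun i _ => ?_
    have h1 : ∑ j, ∫ η in A j, p i η ∂μ ≤ ∫ η, p i η ∂μ := by
      rw [← integral_iUnion_fintype hAm hAd fun j => (hpi i).integrableOn]
      exact setIntegral_le_integral (hpi i) (hp0' i)
    have h2 : RCLike.re (inner ℂ ((μ.real (A i) : ℂ) • kerAt H (z i)) G)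
        = μ.real (A i) * ∫ η, p i η ∂μ := by
      rw [inner_smul_left, hG, ← integral_inner hint, integral_re (hint.const_inner _)]
      simp
    rw [h2]
    simp only [hb, ← Finset.mul_sum]
    calc _ ≤ μ.real (A i) * (C * ∫ η, p i η ∂μ) := by gcongr
      _ = _ := by ring
  -- the unknown norm reappears on the right to the first power only, and is divided out
  have hfin : ‖g‖ ^ 2 ≤ 2 * C * ‖G‖ * ‖g‖ := by
    have h1 : ∑ i, ∑ j, (b i j + b j i) = 2 * ∑ i, ∑ j, b i j := by
      simp only [Finset.sum_add_distrib]
      rw [Finset.sum_comm (f := fun i j => b j i)]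
      ring
    have h2 : RCLike.re (inner ℂ g G) ≤ ‖g‖ * ‖G‖ := re_inner_le_norm g G
    calc ‖g‖ ^ 2 ≤ ∑ i, ∑ j, (b i j + b j i) := by
          rw [hgg]
          exact Finset.sum_le_sum fun i _ => Finset.sum_le_sum fun j _ => hle' i j
      _ ≤ 2 * (C * (‖g‖ * ‖G‖)) := by
          rw [h1]
          have := mul_le_mul_of_nonneg_left h2 hC0.le
          linarith
      _ = _ := by ring
  rcases (norm_nonneg g).eq_or_lt with h | h
  · rw [← h]; positivity
  · exact le_of_mul_le_mul_right (by rwa [sq] at hfin) h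

end RKHS

/-! ### The weak-type inequality -/

/-- The points `ζ` of `ℂ^d` whose Korányi region of aperture `α` meets `S`. Points
off the sphere are included: the outer capacity calls for sets open in the closed ball. -/
def koranyiShadow (α : ℝ) (S : Set (openBall d)) : Set (Cd d) :=
  {ζ | ∃ z ∈ S, z ∈ koranyiRegion α ζ}

lemma isOpen_setOf_mem_koranyiRegion (α : ℝ) (z : openBall d) :
    IsOpen {ζ : Cd d | z ∈ koranyiRegion α ζ} := by
  have h : Continuous fun ζ : Cd d => ip (z : Cd d) ζ :=
    continuous_ip.comp (continuous_const.prodMk continuous_id)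
  exact isOpen_lt (continuous_const.sub h).norm continuous_const

lemma isOpen_koranyiShadow (α : ℝ) (S : Set (openBall d)) : IsOpen (koranyiShadow α S) := by
  have e : koranyiShadow α S = ⋃ z ∈ S, {ζ : Cd d | z ∈ koranyiRegion α ζ} := by
    ext ζ; simp [koranyiShadow]
  rw [e]
  exact isOpen_biUnion fun z _ => isOpen_setOf_mem_koranyiRegion α z

/-- An open cover of a compact set can be refined to a finite measurable partition of the set. -/
lemma exists_disjoint_partition {X κ : Type*} [TopologicalSpace X] [T2Space X]
    [MeasurableSpace X] [OpensMeasurableSpace X] {F : Set X} (hF : IsCompact F) {O : κ → Set X}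
    (hO : ∀ k, IsOpen (O k)) (hFO : F ⊆ ⋃ k, O k) :
    ∃ (n : ℕ) (y : Fin n → κ) (A : Fin n → Set X), (∀ i, MeasurableSet (A i)) ∧
      Pairwise (Function.onFun Disjoint A) ∧ ⋃ i, A i = F ∧ ∀ i, A i ⊆ O (y i) := by
  obtain ⟨I, hI⟩ := hF.elim_finite_subcover O hO hFO
  let y : Fin I.card → κ := fun i => (I.equivFin.symm i).1
  let B : Fin I.card → Set X := fun i => F ∩ O (y i)
  refine ⟨I.card, y, disjointed B,
    fun i => disjointedRec (fun {_} _ ht => ht.diff (hF.measurableSet.inter (hO _).measurableSet))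
      (hF.measurableSet.inter (hO _).measurableSet),
    disjoint_disjointed B, ?_, fun i => (disjointed_le B i).trans inter_subset_right⟩
  rw [iUnion_disjointed]
  refine Subset.antisymm (iUnion_subset fun i => inter_subset_left) fun x hx => ?_
  obtain ⟨k, hk, hxk⟩ := mem_iUnion₂.1 (hI hx)
  refine mem_iUnion.2 ⟨I.equivFin ⟨k, hk⟩, hx, ?_⟩
  simpa [y] using hxk

section RKHS

variable {H : Type*} [NormedAddCommGroup H] [InnerProductSpace ℂ H] [CompleteSpace H]
  [RKHS ℂ H (openBall d) ℂ] {K : Cd d → Cd d → ℂ}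

/-- Pairing `h` with the sum of point masses `∑ i, μ (A i) K(·, z i)`, where `Re h (z i) > t`, gives
at least `t μ F` and at most `‖h‖` times the norm bounded in `norm_sum_kerAt_le`. -/
lemma measure_compact_mul_le (hH : RKHS.kernel H = kernelMatrix K) (hK : HarnackKernel K)
    {α C : ℝ} (hC0 : 0 < C) (hC : HarnackBound K α C)
    {μ : Measure (Cd d)} [IsFiniteMeasure μ] (hμ : μ (closedBall d)ᶜ = 0)
    {e : ℝ} (he : energy K μ ≤ ENNReal.ofReal e) (he0 : 0 ≤ e) (h : H) {t : ℝ}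
    {F : Set (Cd d)} (hF : IsCompact F) (hFB : F ⊆ closedBall d)
    (hFS : F ⊆ koranyiShadow α {z | t < (h z).re}) :
    t * μ.real F ≤ 2 * C * ‖h‖ * √e := by
  obtain ⟨n, y, A, hAm, hAd, hAF, hAO⟩ := exists_disjoint_partition hF
    (O := fun z : {z : openBall d // t < (h z).re} => {ζ : Cd d | z.1 ∈ koranyiRegion α ζ})
    (fun z => isOpen_setOf_mem_koranyiRegion α z.1) fun ζ hζ => by
      obtain ⟨z, hz, hzζ⟩ := hFS hζ
      exact mem_iUnion.2 ⟨⟨z, hz⟩, hzζ⟩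
  obtain ⟨z, hz⟩ : ∃ z : Fin n → openBall d, ∀ i, z i = (y i).1 := ⟨_, fun _ => rfl⟩
  have hzt : ∀ i, t < (h (z i)).re := fun i => by rw [hz]; exact (y i).2
  have hA : ∀ i, ∀ η ∈ A i, η ∈ closedBall d ∧ z i ∈ koranyiRegion α η := fun i η hη => by
    rw [hz]
    exact ⟨hFB (hAF ▸ mem_iUnion_of_mem i hη), hAO i hη⟩
  clear hz hAO
  -- a radius `s < 1` beyond all the points `z i`
  obtain ⟨s, hs, hzs⟩ : ∃ s ∈ Ico (0 : ℝ) 1, ∀ i, ‖(z i : Cd d)‖ ≤ s := by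
    have h1 : ∀ᶠ s in 𝓝[<] (1 : ℝ), ∀ i, ‖(z i : Cd d)‖ ≤ s := by
      rw [eventually_all]
      intro i
      filter_upwards [Ioo_mem_nhdsLT (mem_ball_zero_iff.1 (z i).2)] with s hs using hs.1.le
    obtain ⟨s, h2, h3⟩ := (h1.and (Ico_mem_nhdsLT (zero_lt_one' ℝ))).exists
    exact ⟨s, h3, h2⟩
  have hg := norm_sum_kerAt_le hH hK hC0 hC hs hμ hzs hAm hAd hA
  have hG : ‖∫ η, dilKer H s η ∂μ‖ ≤ √e := by
    refine Real.le_sqrt_of_sq_le ?_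
    exact (ENNReal.ofReal_le_ofReal_iff he0).1
      ((ofReal_norm_integral_dilKer_sq_le hH hK hs hμ).trans he)
  have hμF : μ.real F = ∑ i, μ.real (A i) := by
    rw [← hAF, measureReal_iUnion_fintype hAd hAm]
  calc t * μ.real F ≤ ∑ i, μ.real (A i) * (h (z i)).re := by
        rw [hμF, Finset.mul_sum]
        refine Finset.sum_le_sum fun i _ => ?_
        rw [mul_comm]
        exact mul_le_mul_of_nonneg_left (hzt i).le measureReal_nonneg
    _ = RCLike.re (inner ℂ (∑ i, (μ.real (A i) : ℂ) • kerAt H (z i)) h) := by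
        rw [sum_inner, map_sum]
        refine Finset.sum_congr rfl fun i _ => ?_
        rw [inner_smul_left, inner_kerAt_left]
        simp
    _ ≤ ‖∑ i, (μ.real (A i) : ℂ) • kerAt H (z i)‖ * ‖h‖ := re_inner_le_norm _ _
    _ ≤ (2 * C * √e) * ‖h‖ := by
        gcongr
        exact hg.trans (by gcongr)
    _ = _ := by ring

omit [CompleteSpace H] in
/-- A point where `h` is large in modulus is one where a rotation of `h` by a fourth root of unity
has large real part. -/
lemma koranyiShadow_norm_subset (α t : ℝ) (h : H) :
    koranyiShadow α {z | 2 * t < ‖h z‖} ⊆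
      ⋃ j : Fin 4, koranyiShadow α {z | t < ((Complex.I ^ (j : ℕ) • h : H) z).re} := by
  rintro ζ ⟨z, hz, hzζ⟩
  have h1 : ‖h z‖ ≤ |(h z).re| + |(h z).im| := Complex.norm_le_abs_re_add_abs_im _
  have h2 : 2 * t < ‖h z‖ := hz
  rw [mem_iUnion]
  by_contra! hcon
  have h3 : ∀ j : Fin 4, ((Complex.I ^ (j : ℕ) • h : H) z).re ≤ t := fun j => by
    by_contra! h4
    exact hcon j ⟨z, h4, hzζ⟩
  have h30 := h3 0
  have h31 := h3 1
  have h32 := h3 2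
  have h33 := h3 3
  simp [pow_succ] at h30 h31 h32 h33
  have h4 : |(h z).re| ≤ t := abs_le.2 ⟨by linarith, by linarith⟩
  have h5 : |(h z).im| ≤ t := abs_le.2 ⟨by linarith, by linarith⟩
  linarith

/-- The capacitary weak-type inequality for the Korányi maximal function, in the form of a bound on
each measure of finite energy. This form, unlike a bound on the capacity of the set, passes to
countable unions by the subadditivity of measures. -/
theorem exists_measure_koranyiShadow_le (hH : RKHS.kernel H = kernelMatrix K)
    (hK : HarnackKernel K) (α : ℝ) :
    ∃ C : ℝ, 0 < C ∧ ∀ (μ : Measure (Cd d)) [IsFiniteMeasure μ], μ (closedBall d)ᶜ = 0 →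
      ∀ e : ℝ, 0 ≤ e → energy K μ ≤ ENNReal.ofReal e → ∀ (h : H) (t : ℝ), 0 < t →
        μ (koranyiShadow α {z | t < ‖h z‖}) ≤ ENNReal.ofReal (C * ‖h‖ / t * √e) := by
  obtain ⟨C, hC0, hC⟩ := hK.harnack α
  refine ⟨16 * C, by positivity, fun μ _ hμ e he0 he h t ht => ?_⟩
  have key : ∀ g : H, μ (koranyiShadow α {z | t / 2 < (g z).re}) ≤
      ENNReal.ofReal (4 * C * ‖g‖ / t * √e) := by
    intro g
    have hm : μ (koranyiShadow α {z | t / 2 < (g z).re}) =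
        μ (koranyiShadow α {z | t / 2 < (g z).re} ∩ closedBall d) := by
      refine (measure_inter_conull' ?_).symm
      exact measure_mono_null (fun x hx => hx.2) hμ
    rw [hm, ((isOpen_koranyiShadow α _).measurableSet.inter
      Metric.isClosed_closedBall.measurableSet).measure_eq_iSup_isCompact]
    refine iSup_le fun F => iSup_le fun hFS => iSup_le fun hF => ?_
    have h1 := measure_compact_mul_le hH hK hC0 hC hμ he he0 g (t := t / 2) hF
      (hFS.trans inter_subset_right) (hFS.trans inter_subset_left)
    rw [← ofReal_measureReal]
    refine ENNReal.ofReal_le_ofReal ?_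
    rw [div_mul_eq_mul_div, le_div_iff₀ ht]
    linarith
  have h0 := koranyiShadow_norm_subset α (t / 2) h
  rw [mul_div_cancel₀ t two_ne_zero] at h0
  calc _ ≤ ∑ j : Fin 4, μ (koranyiShadow α {z | t / 2 < ((Complex.I ^ (j : ℕ) • h : H) z).re}) :=
        (measure_mono h0).trans (measure_iUnion_fintype_le _ _)
    _ ≤ ∑ j : Fin 4, ENNReal.ofReal (4 * C * ‖h‖ / t * √e) := by
        refine Finset.sum_le_sum fun j _ => ?_
        simpa [norm_smul] using key (Complex.I ^ (j : ℕ) • h)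
    _ = _ := by
        rw [← ENNReal.ofReal_sum_of_nonneg (fun _ _ => by positivity), Finset.sum_const]
        simp only [Finset.card_univ, Fintype.card_fin, nsmul_eq_mul]
        congr 1
        push_cast
        ring

/-- Linear combinations of kernel functions have limits at all points of the sphere. -/
lemma tendsto_of_mem_span (hH : RKHS.kernel H = kernelMatrix K) (hK : HarnackKernel K)
    {p : H} (hp : p ∈ Submodule.span ℂ {x | ∃ (w : openBall d) (v : ℂ), RKHS.kerFun H w v = x})
    {ζ : Cd d} (hζ : ζ ∈ sphere d) :
    ∃ l : ℂ, Tendsto (fun z => p z) (comap ((↑) : openBall d → Cd d) (𝓝 ζ)) (𝓝 l) := by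
  induction hp using Submodule.span_induction with
  | mem x hx =>
    obtain ⟨w, v, rfl⟩ := hx
    refine ⟨K ζ w * v, ?_⟩
    have hne : ip ζ w ≠ 1 :=
      ip_ne_one (mem_sphere_zero_iff_norm.1 hζ).le (mem_ball_zero_iff.1 w.2)
    have h1 : Tendsto (fun z : openBall d => K z w) (comap ((↑) : openBall d → Cd d) (𝓝 ζ))
        (𝓝 (K ζ w)) :=
      (hK.continuousAt hne).tendsto.comp
        ((Continuous.prodMk continuous_id continuous_const).tendsto' ζ (ζ, (w : Cd d)) rfl
          |>.comp tendsto_comap)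
    refine (h1.mul_const v).congr fun z => ?_
    rw [RKHS.kerFun_apply, hH]
    simp [kernelMatrix]
  | zero => exact ⟨0, by simpa using tendsto_const_nhds⟩
  | add x y _ _ hx hy =>
    obtain ⟨a, ha⟩ := hx
    obtain ⟨b, hb⟩ := hy
    exact ⟨a + b, by simpa using ha.add hb⟩
  | smul c x _ hx =>
    obtain ⟨a, ha⟩ := hx
    exact ⟨c * a, by simpa using ha.const_mul c⟩

end RKHS

/-! ### Korányi limits -/

/-- The filter of approach to `ζ` within its Korányi region of aperture `α`. -/
abbrev koranyiFilter (α : ℝ) (ζ : Cd d) : Filter (openBall d) :=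
  comap ((↑) : openBall d → Cd d) (𝓝 ζ) ⊓ 𝓟 (koranyiRegion α ζ)

lemma koranyiRegion_mono {α β : ℝ} (h : α ≤ β) (ζ : Cd d) :
    koranyiRegion α ζ ⊆ koranyiRegion β ζ := fun z hz => by
  have hz1 : ‖(z : Cd d)‖ < 1 := mem_ball_zero_iff.1 z.2
  refine lt_of_lt_of_le (show _ < _ from hz) (?_ : _ ≤ β / 2 * (1 - ‖(z : Cd d)‖ ^ 2))
  have : 0 ≤ 1 - ‖(z : Cd d)‖ ^ 2 := by nlinarith [norm_nonneg (z : Cd d)]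
  gcongr

lemma koranyiFilter_mono {α β : ℝ} (h : α ≤ β) (ζ : Cd d) :
    koranyiFilter α ζ ≤ koranyiFilter β ζ :=
  inf_le_inf_left _ (principal_mono.2 (koranyiRegion_mono h ζ))

lemma neBot_koranyiFilter {α : ℝ} (hα : 1 < α) {ζ : Cd d} (hζ : ζ ∈ sphere d) :
    (koranyiFilter α ζ).NeBot := by
  rw [mem_sphere_zero_iff_norm] at hζ
  have hn : ∀ r ∈ Ioo (0 : ℝ) 1, ‖r • ζ‖ = r := fun r hr => by
    rw [norm_smul, hζ, mul_one, Real.norm_of_nonneg hr.1.le]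
  have hmem : ∀ r ∈ Ioo (0 : ℝ) 1, r • ζ ∈ openBall d := fun r hr => by
    rw [mem_ball_zero_iff, hn r hr]; exact hr.2
  refine Filter.inf_principal_neBot_iff.2 fun S hS => ?_
  obtain ⟨T, hT, hTS⟩ := mem_comap.1 hS
  have h1 : Tendsto (fun r : ℝ => r • ζ) (𝓝[<] 1) (𝓝 ζ) :=
    ((continuous_id.smul continuous_const).tendsto' 1 ζ (one_smul ℝ ζ)).mono_left
      nhdsWithin_le_nhds
  have h2 : ∀ᶠ r in 𝓝[<] (1 : ℝ), 1 < α / 2 * (1 + r) := by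
    refine nhdsWithin_le_nhds (Tendsto.eventually_const_lt (v := α) hα ?_)
    exact Continuous.tendsto' (by fun_prop) 1 α (by ring)
  obtain ⟨r, ⟨hr1, hr2⟩, hr3⟩ :=
    ((h1.eventually hT).and h2 |>.and (Ioo_mem_nhdsLT (zero_lt_one' ℝ))).exists
  refine ⟨⟨r • ζ, hmem r hr3⟩, hTS hr1, ?_⟩
  have e : ip (r • ζ) ζ = (r : ℂ) := by
    have : ip (r • ζ) ζ = r * ip ζ ζ := by simp [ip, Finset.mul_sum, mul_assoc]
    rw [this, ip_eq_inner, inner_self_eq_norm_sq_to_K, hζ]; simp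
  simp only [koranyiRegion, mem_ofPred_eq]
  rw [e, hn r hr3, ← Complex.ofReal_one, ← Complex.ofReal_sub, Complex.norm_real,
    Real.norm_of_nonneg (by linarith [hr3.2])]
  nlinarith [hr3.2]

/-- A function has a Korányi limit if in each Korányi region it is a uniform limit, eventually
near the vertex, of functions with a limit there. -/
lemma exists_hasKoranyiLimit {f : openBall d → ℂ} {p : ℕ → openBall d → ℂ} {ζ : Cd d}
    (hζ : ζ ∈ sphere d) {t : ℕ → ℝ} (ht : Tendsto t atTop (𝓝 0))
    (hp : ∀ n, ∃ l : ℂ, Tendsto (p n) (comap ((↑) : openBall d → Cd d) (𝓝 ζ)) (𝓝 l))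
    (hfp : ∀ᶠ n : ℕ in atTop, ∀ z ∈ koranyiRegion n ζ, ‖f z - p n z‖ ≤ t n) :
    ∃ l : ℂ, HasKoranyiLimit f ζ l := by
  have hlim : ∀ α : ℝ, 1 < α → ∃ l : ℂ, Tendsto f (koranyiFilter α ζ) (𝓝 l) := by
    intro α hα
    have := neBot_koranyiFilter hα hζ
    refine cauchy_map_iff_exists_tendsto.1 ?_
    rw [Metric.cauchy_iff]
    refine ⟨inferInstance, fun ε hε => ?_⟩
    obtain ⟨n, ⟨hn1, hn2⟩, hn3⟩ := ((hfp.and (ht.eventually_lt_const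
      (show 0 < ε / 4 by positivity))).and (eventually_ge_atTop ⌈α⌉₊)).exists
    obtain ⟨l, hl⟩ := hp n
    have h1 : ∀ᶠ z in koranyiFilter α ζ, dist (f z) l < ε / 2 := by
      have h2 : ∀ᶠ z in koranyiFilter α ζ, dist (p n z) l < ε / 4 :=
        (hl.mono_left inf_le_left).eventually (Metric.ball_mem_nhds l (by positivity))
      have h3 : ∀ᶠ z in koranyiFilter α ζ, z ∈ koranyiRegion α ζ :=
        mem_inf_of_right (mem_principal_self _)
      filter_upwards [h2, h3] with z hz2 hz3
      have h4 := hn1 z (koranyiRegion_mono ((Nat.le_ceil α).trans (Nat.cast_le.2 hn3)) ζ hz3)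
      have h5 := dist_triangle (f z) (p n z) l
      rw [dist_eq_norm (f z) (p n z)] at h5
      linarith
    refine ⟨Metric.ball l (ε / 2), h1, fun x hx y hy => ?_⟩
    have h6 := dist_triangle_right x y l
    rw [Metric.mem_ball] at hx hy
    linarith
  obtain ⟨l, hl⟩ := hlim 2 one_lt_two
  refine ⟨l, fun α hα => ?_⟩
  obtain ⟨l', hl'⟩ := hlim (max α 2) (hα.trans_le (le_max_left _ _))
  have := neBot_koranyiFilter one_lt_two hζ
  have e : l' = l :=
    tendsto_nhds_unique (hl'.mono_left (koranyiFilter_mono (le_max_right _ _) ζ)) hl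
  rw [← e]
  exact hl'.mono_left (koranyiFilter_mono (le_max_left _ _) ζ)

/-! ### Exceptional sets of capacity zero -/

lemma outerCap_eq_zero_of_forall {K : Cd d → Cd d → ℂ} {E : Set (Cd d)}
    (h : ∀ c : ℝ, 0 < c → ∃ U : Set (Cd d), IsOpen U ∧ E ⊆ U ∧
      ∀ (μ : Measure (Cd d)) [IsProbabilityMeasure μ], μ (closedBall d)ᶜ = 0 → μ Uᶜ = 0 →
        (energy K μ)⁻¹ ≤ ENNReal.ofReal c) : outerCap K E = 0 := by
  refine le_antisymm (ENNReal.le_of_forall_pos_le_add fun c hc _ => ?_) zero_le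
  obtain ⟨U, hU, hEU, hU'⟩ := h c (by exact_mod_cast hc)
  rw [zero_add]
  refine (iInf₂_le_of_le U hU (iInf_le_of_le hEU le_rfl)).trans ?_
  refine iSup_le fun F => iSup_le fun _ => iSup_le fun hFU => ?_
  refine iSup_le fun μ => iSup_le fun _ => iSup_le fun hμ => ?_
  rw [← ENNReal.ofReal_coe_nnreal]
  refine hU' μ (measure_mono_null (compl_subset_compl.2 fun x hx => (hFU hx).2) hμ)
    (measure_mono_null (compl_subset_compl.2 fun x hx => (hFU hx).1) hμ)

section RKHS

variable {H : Type*} [NormedAddCommGroup H] [InnerProductSpace ℂ H] [CompleteSpace H]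
  [RKHS ℂ H (openBall d) ℂ] {K : Cd d → Cd d → ℂ}

/-- Approximate `f` by combinations `p n` of kernel functions; the exceptional set is the set of the
points of the sphere that see a large value of `f - p n` in their Korányi region of aperture `n`
for infinitely many `n`. -/
theorem exists_koranyi_exceptional_set (hH : RKHS.kernel H = kernelMatrix K)
    (hK : HarnackKernel K) (f : H) :
    ∃ E : Set (Cd d), MeasurableSet E ∧ E ⊆ sphere d ∧ outerCap K E = 0 ∧
      ∀ ζ ∈ sphere d \ E, ∃ l : ℂ, HasKoranyiLimit (fun z => f z) ζ l := by
  choose C hC0 hC using fun n : ℕ => exists_measure_koranyiShadow_le hH hK (n : ℝ)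
  have hdense : ∀ n : ℕ, ∃ p ∈ Submodule.span ℂ {x : H | ∃ (w : openBall d) (v : ℂ),
      RKHS.kerFun H w v = x}, ‖f - p‖ < (1 / 2) ^ n * (1 / 2) ^ n / C n := by
    intro n
    have h1 : f ∈ closure (Submodule.span ℂ {x : H | ∃ (w : openBall d) (v : ℂ),
        RKHS.kerFun H w v = x} : Set H) := by
      rw [← Submodule.topologicalClosure_coe, RKHS.kerFun_dense]
      trivial
    have := hC0 n
    obtain ⟨p, hp, hpd⟩ := Metric.mem_closure_iff.1 h1
      ((1 / 2) ^ n * (1 / 2) ^ n / C n) (by positivity)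
    exact ⟨p, hp, by rwa [← dist_eq_norm]⟩
  choose p hp hpd using hdense
  set U : ℕ → Set (Cd d) := fun n =>
    koranyiShadow (n : ℝ) {z | (1 / 2 : ℝ) ^ n < ‖(f - p n : H) z‖} with hU
  have hUo : ∀ n, IsOpen (U n) := fun n => isOpen_koranyiShadow _ _
  refine ⟨sphere d ∩ limsup U atTop, ?_, inter_subset_left, ?_, ?_⟩
  · exact Metric.isClosed_sphere.measurableSet.inter
      (MeasurableSet.measurableSet_limsup fun n => (hUo n).measurableSet)
  · refine outerCap_eq_zero_of_forall fun c hc => ?_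
    obtain ⟨N, hN⟩ : ∃ N : ℕ, (2 * (1 / 2 : ℝ) ^ N) ^ 2 ≤ c := by
      have h1 : Tendsto (fun N : ℕ => (2 * (1 / 2 : ℝ) ^ N) ^ 2) atTop (𝓝 0) := by
        have := ((tendsto_pow_atTop_nhds_zero_of_lt_one (r := (1 / 2 : ℝ)) (by norm_num)
          (by norm_num)).const_mul 2).pow 2
        simpa using this
      exact (h1.eventually_le_const hc).exists
    refine ⟨⋃ n, U (n + N), isOpen_iUnion fun n => hUo _, ?_, fun μ _ hμ hμU => ?_⟩
    · rintro ζ ⟨-, hζ⟩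
      rw [limsup_eq_iInf_iSup_of_nat'] at hζ
      exact (mem_iInter.1 hζ N)
    · rcases eq_or_ne (energy K μ) ∞ with htop | htop
      · simp [htop]
      set e := (energy K μ).toReal
      have he : energy K μ = ENNReal.ofReal e := (ENNReal.ofReal_toReal htop).symm
      have he0 : 0 ≤ e := ENNReal.toReal_nonneg
      have hsum : HasSum (fun n : ℕ => (1 / 2 : ℝ) ^ (n + N) * √e) (2 * (1 / 2) ^ N * √e) := by
        simp only [pow_add]
        exact (hasSum_geometric_two.mul_right _).mul_right _
      have h1 : (1 : ℝ≥0∞) ≤ ENNReal.ofReal (2 * (1 / 2) ^ N * √e) := by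
        calc (1 : ℝ≥0∞) = μ (⋃ n, U (n + N)) := by
              rw [← measure_univ (μ := μ)]
              exact (measure_of_measure_compl_eq_zero hμU).symm
          _ ≤ ∑' n, μ (U (n + N)) := measure_iUnion_le _
          _ ≤ ∑' n, ENNReal.ofReal ((1 / 2 : ℝ) ^ (n + N) * √e) := by
              refine ENNReal.tsum_le_tsum fun n => ?_
              refine (hC (n + N) μ hμ e he0 he.le (f - p (n + N)) ((1 / 2) ^ (n + N))
                (by positivity)).trans (ENNReal.ofReal_le_ofReal ?_)
              have h2 := hpd (n + N)
              rw [lt_div_iff₀ (hC0 _)] at h2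
              gcongr
              rw [div_le_iff₀ (by positivity)]
              linarith
          _ = _ := by
              rw [← ENNReal.ofReal_tsum_of_nonneg (fun n => by positivity) hsum.summable,
                hsum.tsum_eq]
      have h3 : 1 ≤ 2 * (1 / 2) ^ N * √e := by
        rwa [← ENNReal.ofReal_one, ENNReal.ofReal_le_ofReal_iff (by positivity)] at h1
      have h4 : 1 ≤ (2 * (1 / 2) ^ N) ^ 2 * e := by
        have h5 := one_le_pow₀ h3 (n := 2)
        rwa [mul_pow, Real.sq_sqrt he0] at h5
      have he1 : 0 < e := by
        by_contra h
        rw [le_antisymm (not_lt.1 h) he0] at h4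
        norm_num at h4
      rw [he, ← ENNReal.ofReal_inv_of_pos he1]
      refine ENNReal.ofReal_le_ofReal (le_trans ?_ hN)
      rwa [inv_le_iff_one_le_mul₀ he1]
  · rintro ζ ⟨hζ, hζE⟩
    have h1 : ζ ∉ limsup U atTop := fun h => hζE ⟨hζ, h⟩
    rw [mem_limsup_iff_frequently_mem, not_frequently] at h1
    refine exists_hasKoranyiLimit (p := fun n z => p n z) (t := fun n => (1 / 2) ^ n) hζ
      (tendsto_pow_atTop_nhds_zero_of_lt_one (by norm_num) (by norm_num))
      (fun n => tendsto_of_mem_span hH hK (hp n) hζ) ?_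
    filter_upwards [h1] with n hn z hz
    by_contra! hcon
    exact hn ⟨z, by simpa using hcon, hz⟩

end RKHS

/-- The kernel of `h^2_d` is at most twice the real part of the kernel of `H^2_d`. -/
lemma energy_plhKernel_le {μ : Measure (Cd d)} [IsFiniteMeasure μ] (hμ : μ (closedBall d)ᶜ = 0) :
    energy plhKernel μ ≤ 2 * energy holKernel μ := by
  refine iSup₂_le fun s hs => ?_
  have hH : RKHS.kernel (Hol d) = kernelMatrix holKernel := RKHS.OfKernel.kernel_ofKernel
  have hK := harnackKernel_holKernel (d := d)
  have hae := ae_mem_closedBall hμ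
  have hmem := fun {z : Cd d} (hz : z ∈ closedBall d) =>
    mem_ball_zero_iff.1 (smul_mem_openBall hs hz)
  have hle : ∀ z w : Cd d, (plhKernel z w).re ≤ 2 * (holKernel z w).re := fun z w => by
    rw [plhKernel, Complex.ofReal_re, holKernel]; linarith
  have h2 : ∫ z, ∫ w, (plhKernel (s • z) (s • w)).re ∂μ ∂μ ≤
      ∫ z, 2 * (∫ w, (holKernel (s • z) (s • w)).re ∂μ) ∂μ := by
    have hpos : ∀ z ∈ closedBall d, 0 ≤ᵐ[μ] fun w => (plhKernel (s • z) (s • w)).re :=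
      fun z hz => hae.mono fun w hw =>
        harnackKernel_plhKernel.re_nonneg (hmem hz) (hmem hw)
    refine integral_mono_of_nonneg (hae.mono fun z hz => integral_nonneg_of_ae (hpos z hz))
      ((integrable_integral_kernel_re hH hK hs hμ).const_mul 2) (hae.mono fun z hz => ?_)
    simp only
    rw [← integral_const_mul]
    exact integral_mono_of_nonneg (hpos z hz)
      ((integrable_kernel_re hH hK hs hμ hz).const_mul 2) (ae_of_all _ fun w => hle _ _)
  rw [integral_const_mul] at h2
  calc _ ≤ ENNReal.ofReal (2 * ∫ z, ∫ w, (holKernel (s • z) (s • w)).re ∂μ ∂μ) :=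
        ENNReal.ofReal_le_ofReal h2
    _ = 2 * ENNReal.ofReal (∫ z, ∫ w, (holKernel (s • z) (s • w)).re ∂μ ∂μ) := by
        rw [ENNReal.ofReal_mul zero_le_two]; simp
    _ ≤ _ := by
        gcongr
        exact le_iSup₂ (f := fun r (_ : r ∈ Ico (0 : ℝ) 1) =>
          ENNReal.ofReal (∫ z, ∫ w, (holKernel (r • z) (r • w)).re ∂μ ∂μ)) s hs

lemma outerCap_holKernel_le (E : Set (Cd d)) :
    outerCap holKernel E ≤ 2 * outerCap plhKernel E := by
  simp only [outerCap, ENNReal.mul_iInf_of_ne two_ne_zero ENNReal.ofNat_ne_top]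
  refine iInf_mono fun U => iInf_mono fun _ => iInf_mono fun _ => ?_
  refine iSup_le fun F => iSup_le fun hF => iSup_le fun hFU => ?_
  refine iSup_le fun μ => iSup_le fun hp => iSup_le fun hμ => ?_
  have h1 := energy_plhKernel_le
    (measure_mono_null (compl_subset_compl.2 fun x hx => (hFU hx).2) hμ)
  have h2 : (energy plhKernel μ)⁻¹ ≤ innerCap plhKernel (U ∩ closedBall d) :=
    le_iSup_of_le F <| le_iSup_of_le hF <| le_iSup_of_le hFU <|
      le_iSup_of_le μ <| le_iSup_of_le hp <| le_iSup_of_le hμ le_rfl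
  refine le_trans ?_ (mul_le_mul_right h2 2)
  rw [← ENNReal.inv_le_inv, inv_inv,
    ENNReal.mul_inv (Or.inl two_ne_zero) (Or.inl ENNReal.ofNat_ne_top), inv_inv]
  rw [mul_comm, ← div_eq_mul_inv]
  exact ENNReal.div_le_of_le_mul' h1

end DruryArveson

end

theorem theorem1p1 (d : ℕ) :
    (∀ f : DruryArveson.Hol d, ∃ E : Set (DruryArveson.Cd d),
      MeasurableSet E ∧ E ⊆ DruryArveson.sphere d ∧
      DruryArveson.outerCap DruryArveson.holKernel E = 0 ∧
      ∀ ζ ∈ DruryArveson.sphere d \ E, ∃ l : ℂ,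
        DruryArveson.HasKoranyiLimit (fun z => f z) ζ l) ∧
    (∀ f : DruryArveson.Plh d, ∃ E : Set (DruryArveson.Cd d),
      MeasurableSet E ∧ E ⊆ DruryArveson.sphere d ∧
      DruryArveson.outerCap DruryArveson.plhKernel E = 0 ∧
      DruryArveson.outerCap DruryArveson.holKernel E = 0 ∧
      ∀ ζ ∈ DruryArveson.sphere d \ E, ∃ l : ℂ,
        DruryArveson.HasKoranyiLimit (fun z => f z) ζ l) := by
  refine ⟨fun f => DruryArveson.exists_koranyi_exceptional_set RKHS.OfKernel.kernel_ofKernel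
    DruryArveson.harnackKernel_holKernel f, fun f => ?_⟩
  obtain ⟨E, hE, hES, hcap, hlim⟩ := DruryArveson.exists_koranyi_exceptional_set
    RKHS.OfKernel.kernel_ofKernel DruryArveson.harnackKernel_plhKernel f
  refine ⟨E, hE, hES, hcap, ?_, hlim⟩
  have h := DruryArveson.outerCap_holKernel_le E
  rw [hcap, mul_zero] at h
  exact le_antisymm h zero_le
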